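/- Let $K$ be a field with $\operatorname{char} K\neq 2,3$, let $\overline K$ be an algebraic closure of $K$, and let $\mathcal E_2: y^2=x^3+c$ with $c\in K$ be an elliptic curve (so $c\neq 0$). Let $K_7=K(\mathcal E_2[7])\subseteq\overline K$ be the field obtained by adjoining to $K$ the coordinates of all points $P\in\mathcal E_2(\overline K)$ with $7P=O$. Let $\mathrm{Dic}_3=\langle a,x \mid a^6=1,\ x^2=a^3,\ xax^{-1}=a^{-1}\rangle$ be the dicyclic group of order $12$, and let $\mathrm{Dic}_3\rtimes\mathbb Z/6\mathbb Z$ be the semidirect product in which a generator of $\mathbb Z/6\mathbb Z$ acts on $\mathrm{Dic}_3$ by the automorphism $a\mapsto a$, $x\mapsto x^{-1}$. Then: 1. $K_7/K$ is a Galois extension, and $\operatorname{Gal}(K_7/K)$ is isomorphic to a subgroup of $\mathrm{Dic}_3\rtimes\mathbb Z/6\mathbb Z$. 2. If $[K_7:K]=72$, then $\operatorname{Gal}(K_7/K)\simeq \mathrm{Dic}_3\rtimes\mathbb Z/6\mathbb Z$. 3. This semidirect product is not the direct product: $\mathrm{Dic}_3\rtimes\mathbb Z/6\mathbb Z\not\simeq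 \mathrm{Dic}_3\times\mathbb Z/6\mathbb Z$. -/

import Mathlib

/-- The Weierstrass curve `y² = x³ + c`. -/
def mordellCurve {K : Type*} [CommRing K] (c : K) : WeierstrassCurve K where
  a₁ := 0
  a₂ := 0
  a₃ := 0
  a₄ := 0
  a₆ := c

/-- The coordinates, in the extension `L` of `K`, of the affine `L`-rational points `P` of `W`
with `m • P = 0`. -/
def torsionCoordinates {K : Type*} [Field K] (W : WeierstrassCurve K)
    (L : Type*) [Field L] [Algebra K L] [DecidableEq L] (m : ℕ) : Set L :=
  {z | ∃ (x y : L) (h : (W.baseChange L).toAffine.Nonsingular x y),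
    m • WeierstrassCurve.Affine.Point.some x y h = 0 ∧ (z = x ∨ z = y)}

/-- The `m`-th division field `K(W[m])` inside `L`; to be used with `L` an algebraic closure
of `K`. -/
def divisionField {K : Type*} [Field K] (W : WeierstrassCurve K)
    (L : Type*) [Field L] [Algebra K L] [DecidableEq L] (m : ℕ) : IntermediateField K L :=
  IntermediateField.adjoin K (torsionCoordinates W L m)

/-- The dicyclic group of order 12. Its elements are `a i` and `xa i` with `i : ZMod 6`; here `a 1`
has order 6, `xa 0` has order 4, `(xa 0)² = (a 1)³`, and `xa 0` inverts `a 1`. -/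
abbrev Dic3 : Type := QuaternionGroup 3

/-- The cyclic group of order 6, written multiplicatively. -/
abbrev C6 : Type := Multiplicative (ZMod 6)

/-- The map `a i ↦ a i`, `xa i ↦ xa (i + 3k)`. For odd `k` it fixes the cyclic subgroup of order 6
and sends each element of order 4 to its inverse; for even `k` it is the identity. -/
def dic3Twist (k : ZMod 6) : Dic3 → Dic3
  | .a i => .a i
  | .xa i => .xa (i + 3 * k : ZMod 6)

/-- The action of the cyclic group of order 6 on the dicyclic group of order 12 in which a
generator fixes the cyclic subgroup of order 6 and inverts the elements of order 4. -/
def dic3Action : C6 →* MulAut Dic3 where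
  toFun k :=
    { toFun := dic3Twist k.toAdd
      invFun := dic3Twist (-k.toAdd)
      left_inv := by revert k; decide
      right_inv := by revert k; decide
      map_mul' := by revert k; decide }
  map_one' := by ext g; revert g; decide
  map_mul' k l := by
    ext g
    revert k l g
    decide

/-- The semidirect product `Dic₃ ⋊ ℤ/6ℤ` for the action `dic3Action`. -/
abbrev Dic3SemidirectC6 : Type := Dic3 ⋊[dic3Action] C6

/-!
A primitive cube root of unity `ω` acts on `E : y² = x³ + c` by `ρ (x, y) = (ωx, y)`, and
`ρ² + ρ + 1 = 0`. Since `X² + X + 1 = (X - 2)(X - 4)` modulo `7`, the `7`-torsion is the direct sum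
of the eigenspaces of `ρ` for `2` and `4`; the second is the eigenspace of `ρ²` for `2`. The
equation `ρ P = 2P` determines `x(P)³`, hence `P` up to sign and powers of `ρ`, so each eigenspace
is cyclic. A Galois automorphism commutes with `ρ` or replaces it by `ρ²`, so it fixes or exchanges
the two eigenlines, and the image of Galois lies in the group of monomial matrices in `GL₂(𝔽₇)`,
which is `Dic₃ ⋊ ℤ/6ℤ`. In characteristic `7` one of the eigenspaces may vanish; then Galois acts
through scalars.
-/

section MonomialMatrices

/-- A `2 × 2` matrix that is diagonal or antidiagonal. The invertible ones are those that permute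
the two coordinate axes. -/
def IsMonomialMatrix {R : Type*} [Zero R] (A : Matrix (Fin 2) (Fin 2) R) : Prop :=
  (A 0 1 = 0 ∧ A 1 0 = 0) ∨ (A 0 0 = 0 ∧ A 1 1 = 0)

/-- `Dic₃` as a group of monomial matrices over `𝔽₇`: the generator of order 6 is `diag(3, 3⁻¹)`,
where `3` is a primitive root modulo `7`, and `x` is the rotation by a right angle. -/
def dic3Matrix : Dic3 →* Matrix (Fin 2) (Fin 2) (ZMod 7) where
  toFun
    | .a i => !![3 ^ (i : ZMod 6).val, 0; 0, 5 ^ (i : ZMod 6).val]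
    | .xa i => !![0, 5 ^ (i : ZMod 6).val; -3 ^ (i : ZMod 6).val, 0]
  map_one' := by decide
  map_mul' := by decide

/-- `ℤ/6ℤ` as the group of matrices over `𝔽₇` generated by `diag(3, -3)`: the sign makes
conjugation invert the rotation by a right angle. -/
def c6Matrix : C6 →* Matrix (Fin 2) (Fin 2) (ZMod 7) where
  toFun k := !![3 ^ k.toAdd.val, 0; 0, (-3) ^ k.toAdd.val]
  map_one' := by decide
  map_mul' := by decide

lemma c6Matrix_mul_dic3Matrix : ∀ (k : C6) (g : Dic3),
    c6Matrix k * dic3Matrix g = dic3Matrix (dic3Action k g) * c6Matrix k := by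
  decide

lemma eq_one_of_dic3Matrix_mul_c6Matrix_eq_one : ∀ (g : Dic3) (k : C6),
    dic3Matrix g * c6Matrix k = 1 → g = 1 ∧ k = 1 := by
  decide

lemma exists_dic3Matrix_a_mul_c6Matrix_eq : ∀ a b : ZMod 7, a * b ≠ 0 →
    ∃ (i : ZMod 6) (k : C6), dic3Matrix (.a i) * c6Matrix k = !![a, 0; 0, b] := by
  decide

lemma exists_dic3Matrix_xa_mul_c6Matrix_eq : ∀ a b : ZMod 7, a * b ≠ 0 →
    ∃ (i : ZMod 6) (k : C6), dic3Matrix (.xa i) * c6Matrix k = !![0, a; b, 0] := by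
  decide

/-- The faithful representation of `Dic₃ ⋊ ℤ/6ℤ` on `𝔽₇²` by monomial matrices. -/
def monomialRep : Dic3SemidirectC6 →* GL (Fin 2) (ZMod 7) :=
  SemidirectProduct.lift dic3Matrix.toHomUnits c6Matrix.toHomUnits fun k ↦ by
    ext1 g
    rw [MonoidHom.comp_apply, MonoidHom.comp_apply, MulEquiv.coe_toMonoidHom,
      MulEquiv.coe_toMonoidHom, MulAut.conj_apply, eq_mul_inv_iff_mul_eq]
    exact Units.ext (c6Matrix_mul_dic3Matrix k g).symm

lemma coe_monomialRep (d : Dic3SemidirectC6) :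
    (monomialRep d : Matrix (Fin 2) (Fin 2) (ZMod 7)) = dic3Matrix d.left * c6Matrix d.right :=
  rfl

lemma monomialRep_injective : Function.Injective monomialRep := by
  refine (injective_iff_map_eq_one _).2 fun d hd ↦ ?_
  obtain ⟨hl, hr⟩ := eq_one_of_dic3Matrix_mul_c6Matrix_eq_one d.left d.right
    (congrArg Units.val hd)
  exact SemidirectProduct.ext hl hr

instance fact_prime_seven : Fact (Nat.Prime 7) := ⟨by norm_num⟩

lemma mem_range_monomialRep {A : GL (Fin 2) (ZMod 7)} (hA : IsMonomialMatrix A.val) :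
    A ∈ monomialRep.range := by
  have hdet : A.val 0 0 * A.val 1 1 - A.val 0 1 * A.val 1 0 ≠ 0 := by
    rw [← Matrix.det_fin_two]
    exact (A.isUnit.map Matrix.detMonoidHom).ne_zero
  rcases hA with ⟨h01, h10⟩ | ⟨h00, h11⟩
  · obtain ⟨i, k, hik⟩ := exists_dic3Matrix_a_mul_c6Matrix_eq (A.val 0 0) (A.val 1 1)
      (by simpa [h01] using hdet)
    refine ⟨⟨.a i, k⟩, Units.ext ?_⟩
    rw [coe_monomialRep, hik, A.val.eta_fin_two, h01, h10]
    simp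
  · obtain ⟨i, k, hik⟩ := exists_dic3Matrix_xa_mul_c6Matrix_eq (A.val 0 1) (A.val 1 0)
      (by simpa [h00] using hdet)
    refine ⟨⟨.xa i, k⟩, Units.ext ?_⟩
    rw [coe_monomialRep, hik, A.val.eta_fin_two, h00, h11]
    simp

lemma exists_monoidHom_ker_eq_of_isMonomialMatrix {G : Type*} [Group G]
    (F : G →* Matrix (Fin 2) (Fin 2) (ZMod 7)) (hF : ∀ g, IsMonomialMatrix (F g)) :
    ∃ f : G →* Dic3SemidirectC6, f.ker = F.ker := by
  let e := MonoidHom.ofInjective monomialRep_injective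
  let F' : G →* monomialRep.range :=
    F.toHomUnits.codRestrict _ fun g ↦ mem_range_monomialRep (hF g)
  refine ⟨e.symm.toMonoidHom.comp F', Subgroup.ext fun g ↦ ?_⟩
  calc e.symm (F' g) = 1 ↔ F' g = 1 := map_eq_one_iff _ e.symm.injective
    _ ↔ F.toHomUnits g = 1 := Subtype.ext_iff
    _ ↔ F g = 1 := Units.ext_iff

end MonomialMatrices

section Dic3SemidirectC6

lemma card_dic3SemidirectC6 : Nat.card Dic3SemidirectC6 = 72 := by
  rw [Nat.card_congr SemidirectProduct.equivProd, Nat.card_prod]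
  simp [QuaternionGroup.card]

lemma mul_comm_of_mul_self_eq_one_dic3_prod_c6 (g h : Dic3 × C6) (hg : g * g = 1) :
    g * h = h * g := by
  have hDic3 : ∀ g h : Dic3, g * g = 1 → g * h = h * g := by decide
  exact Prod.ext (hDic3 _ _ (congrArg Prod.fst hg)) (mul_comm _ _)

lemma isEmpty_dic3SemidirectC6_mulEquiv_prod : IsEmpty (Dic3SemidirectC6 ≃* Dic3 × C6) := by
  refine ⟨fun e ↦ ?_⟩
  let s : Dic3SemidirectC6 := ⟨.xa 0, .ofAdd 3⟩
  let t : Dic3SemidirectC6 := ⟨.a 1, 1⟩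
  have hs : s * s = 1 := by decide
  have hst : s * t ≠ t * s := by decide
  refine hst (e.injective ?_)
  rw [map_mul, map_mul]
  exact mul_comm_of_mul_self_eq_one_dic3_prod_c6 _ _ (by rw [← map_mul, hs, map_one])

end Dic3SemidirectC6

section Eigenlines

open Module

lemma end_eq_one_of_det_eq_one {k V : Type*} [Field k] [AddCommGroup V] [Module k V]
    (hV : (⊤ : Submodule k V).IsPrincipal) {f : End k V} (hf : LinearMap.det f = 1) : f = 1 := by
  have : Module.Finite k V := ⟨Submodule.IsPrincipal.fg hV⟩
  rcases Nat.le_one_iff_eq_zero_or_eq_one.1 (finrank_le_one_iff_top_isPrincipal.2 hV) with h | h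
  · have : Subsingleton V := finrank_zero_iff.1 h
    exact Subsingleton.elim _ _
  · obtain ⟨a, rfl, -⟩ := f.existsUnique_eq_smul_id_of_finrank_eq_one h
    rw [LinearMap.det_smul, h, LinearMap.det_id, mul_one, pow_one] at hf
    rw [hf, one_smul, End.one_eq_id]

lemma exists_basis_of_isCompl_span_singleton {k V : Type*} [Field k] [AddCommGroup V] [Module k V]
    {v w : V} (hv : v ≠ 0) (hw : w ≠ 0) (h : IsCompl (k ∙ v) (k ∙ w)) :
    ∃ b : Basis (Fin 2) k V, b 0 = v ∧ b 1 = w := by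
  have hli : LinearIndependent k ![v, w] := by
    refine (LinearIndependent.pair_iff' hv).2 fun a ha ↦ hw ?_
    refine (Submodule.disjoint_span_singleton.1 h.disjoint) ?_
    exact Submodule.mem_span_singleton.2 ⟨a, ha⟩
  have hsp : ⊤ ≤ Submodule.span k (Set.range ![v, w]) := by
    rw [Matrix.range_cons_cons_empty, Submodule.span_insert, h.sup_eq_top]
  exact ⟨.mk hli hsp, by simp, by simp⟩

lemma isMonomialMatrix_toMatrixAlgEquiv {k V : Type*} [Field k] [AddCommGroup V] [Module k V]
    (b : Basis (Fin 2) k V) {f : End k V}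
    (hf : (f (b 0) ∈ k ∙ b 0 ∧ f (b 1) ∈ k ∙ b 1) ∨ (f (b 0) ∈ k ∙ b 1 ∧ f (b 1) ∈ k ∙ b 0)) :
    IsMonomialMatrix (LinearMap.toMatrixAlgEquiv b f) := by
  simp only [Submodule.mem_span_singleton] at hf
  simp only [IsMonomialMatrix, LinearMap.toMatrixAlgEquiv_apply]
  rcases hf with ⟨⟨r, hr⟩, s, hs⟩ | ⟨⟨r, hr⟩, s, hs⟩
  · exact .inl (by simp [← hr, ← hs])
  · exact .inr (by simp [← hr, ← hs])

lemma isCompl_eigenspace {k V : Type*} [Field k] [AddCommGroup V] [Module k V] {f : End k V}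
    {a b : k} (hab : a ≠ b) (hf : (f - a • 1) * (f - b • 1) = 0) :
    IsCompl (f.eigenspace a) (f.eigenspace b) := by
  open Polynomial in
  have hcop : IsCoprime (X - C a) (X - C b) :=
    isCoprime_X_sub_C_of_isUnit_sub (sub_ne_zero.2 hab).isUnit
  have haeval (c : k) : aeval f (X - C c) = f - c • 1 := by
    rw [map_sub, aeval_X, aeval_C, Algebra.algebraMap_eq_smul_one]
  rw [End.eigenspace_def, End.eigenspace_def, ← haeval, ← haeval]
  refine ⟨disjoint_ker_aeval_of_isCoprime f hcop, codisjoint_iff.2 ?_⟩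
  rw [sup_ker_aeval_eq_ker_aeval_mul_of_coprime f hcop, map_mul, haeval, haeval, hf,
    LinearMap.ker_zero]

lemma eigenspace_le_comap_of_mul_eq {R M : Type*} [CommRing R] [AddCommGroup M] [Module R M]
    {f g g' : End R M} (h : f * g = g' * f) (μ : R) :
    g.eigenspace μ ≤ (g'.eigenspace μ).comap f := by
  intro v hv
  rw [Submodule.mem_comap, End.mem_eigenspace_iff]
  calc g' (f v) = f (g v) := (LinearMap.congr_fun h v).symm
    _ = μ • f v := by rw [End.mem_eigenspace_iff.1 hv, map_smul]

lemma eigenspace_sq_eq {R M : Type*} [CommRing R] [AddCommGroup M] [Module R M] {ρ : End R M}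
    (hρ : ρ ^ 2 + ρ + 1 = 0) (μ : R) : (ρ ^ 2).eigenspace μ = ρ.eigenspace (-1 - μ) := by
  have hsq : ρ ^ 2 - μ • 1 = -(ρ - (-1 - μ) • 1) := by
    rw [sub_smul, neg_smul, one_smul, ← sub_eq_zero, ← hρ]
    abel
  rw [End.eigenspace_def, End.eigenspace_def, hsq, LinearMap.ker_neg]

lemma isCompl_eigenspace_two_four {V : Type*} [AddCommGroup V] [Module (ZMod 7) V]
    {ρ : End (ZMod 7) V} (hρ : ρ ^ 2 + ρ + 1 = 0) :
    IsCompl (ρ.eigenspace 2) (ρ.eigenspace 4) := by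
  have h24 : (2 : ZMod 7) ≠ 4 := by decide
  refine isCompl_eigenspace h24 ?_
  calc (ρ - (2 : ZMod 7) • 1) * (ρ - (4 : ZMod 7) • 1)
      = ρ ^ 2 + (-6 : ZMod 7) • ρ + (8 : ZMod 7) • 1 := by
        simp only [sub_mul, mul_sub, smul_mul_assoc, mul_smul_comm, one_mul, mul_one, sq]
        module
    _ = ρ ^ 2 + (1 : ZMod 7) • ρ + (1 : ZMod 7) • 1 := rfl
    _ = 0 := by rw [one_smul, one_smul, hρ]

section Representation

variable {G V : Type*} [Group G] [AddCommGroup V] [Module (ZMod 7) V]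
  (φ : Representation (ZMod 7) G V)

lemma exists_monoidHom_ker_eq_of_top_isPrincipal
    (hV : (⊤ : Submodule (ZMod 7) V).IsPrincipal) :
    ∃ f : G →* Dic3SemidirectC6, f.ker = φ.ker := by
  let F : G →* Matrix (Fin 2) (Fin 2) (ZMod 7) :=
    (Matrix.scalar (Fin 2)).toMonoidHom.comp (LinearMap.det.comp φ)
  obtain ⟨f, hf⟩ := exists_monoidHom_ker_eq_of_isMonomialMatrix F fun g ↦ .inl ⟨rfl, rfl⟩
  refine ⟨f, hf.trans (Subgroup.ext fun g ↦ ?_)⟩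
  calc F g = 1 ↔ LinearMap.det (φ g) = 1 := Matrix.scalar_inj (n := Fin 2) (s := 1)
    _ ↔ φ g = 1 := ⟨end_eq_one_of_det_eq_one hV, fun h ↦ by rw [h, map_one]⟩

lemma exists_monoidHom_ker_eq_of_isCompl {A B : Submodule (ZMod 7) V} (hAB : IsCompl A B)
    (hA : A.IsPrincipal) (hB : B.IsPrincipal)
    (hφ : ∀ g, (A ≤ A.comap (φ g) ∧ B ≤ B.comap (φ g)) ∨
      (A ≤ B.comap (φ g) ∧ B ≤ A.comap (φ g))) :
    ∃ f : G →* Dic3SemidirectC6, f.ker = φ.ker := by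
  obtain ⟨v, rfl⟩ := hA
  obtain ⟨w, rfl⟩ := hB
  rcases eq_or_ne v 0 with rfl | hv
  · rw [Submodule.span_zero_singleton] at hAB
    exact exists_monoidHom_ker_eq_of_top_isPrincipal φ ⟨w, (eq_top_of_bot_isCompl hAB).symm⟩
  rcases eq_or_ne w 0 with rfl | hw
  · rw [Submodule.span_zero_singleton] at hAB
    exact exists_monoidHom_ker_eq_of_top_isPrincipal φ ⟨v, (eq_top_of_isCompl_bot hAB).symm⟩
  obtain ⟨b, rfl, rfl⟩ := exists_basis_of_isCompl_span_singleton hv hw hAB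
  let F : G →* Matrix (Fin 2) (Fin 2) (ZMod 7) :=
    (LinearMap.toMatrixAlgEquiv b : End (ZMod 7) V →* _).comp φ
  have hF (g : G) : IsMonomialMatrix (F g) := by
    refine isMonomialMatrix_toMatrixAlgEquiv b ?_
    simpa only [Submodule.span_singleton_le_iff_mem, Submodule.mem_comap] using hφ g
  obtain ⟨f, hf⟩ := exists_monoidHom_ker_eq_of_isMonomialMatrix F hF
  exact ⟨f, hf.trans (Subgroup.ext fun g ↦
    map_eq_one_iff (LinearMap.toMatrixAlgEquiv b) (LinearMap.toMatrixAlgEquiv b).injective)⟩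

lemma exists_monoidHom_ker_eq_of_semilinear {ρ : End (ZMod 7) V} (hρ : ρ ^ 2 + ρ + 1 = 0)
    (h2 : (ρ.eigenspace 2).IsPrincipal) (h4 : (ρ.eigenspace 4).IsPrincipal)
    (hφ : ∀ g, φ g * ρ = ρ * φ g ∨ φ g * ρ = ρ ^ 2 * φ g) :
    ∃ f : G →* Dic3SemidirectC6, f.ker = φ.ker := by
  refine exists_monoidHom_ker_eq_of_isCompl φ (isCompl_eigenspace_two_four hρ) h2 h4 fun g ↦ ?_
  refine (hφ g).imp
    (fun h ↦ ⟨eigenspace_le_comap_of_mul_eq h 2, eigenspace_le_comap_of_mul_eq h 4⟩)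
    (fun h ↦ ⟨?_, ?_⟩)
  · exact (eigenspace_le_comap_of_mul_eq h 2).trans_eq (by rw [eigenspace_sq_eq hρ]; rfl)
  · exact (eigenspace_le_comap_of_mul_eq h 4).trans_eq (by rw [eigenspace_sq_eq hρ]; rfl)

end Representation

end Eigenlines

section DivisionFields

open WeierstrassCurve.Affine

lemma nonempty_gal_mulEquiv_range {K L H : Type*} [Field K] [Field L] [Algebra K L] [Normal K L]
    [Group H] (E : IntermediateField K L) [Normal K E] {f : Gal(L/K) →* H}
    (hf : f.ker = E.fixingSubgroup) : Nonempty (Gal(E/K) ≃* f.range) := by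
  rw [← E.restrictNormalHom_ker] at hf
  exact ⟨(QuotientGroup.quotientKerEquivOfSurjective _
    (AlgEquiv.restrictNormalHom_surjective L)).symm.trans
    ((QuotientGroup.quotientMulEquivOfEq hf.symm).trans (QuotientGroup.quotientKerEquivRange f))⟩

lemma mem_separableClosure_of_pow_mem {K L : Type*} [Field K] [Field L] [Algebra K L] {n : ℕ}
    (hn : (n : K) ≠ 0) {z : L} (h : z ^ n ∈ separableClosure K L) :
    z ∈ separableClosure K L := by
  rcases eq_or_ne z 0 with rfl | hz
  · exact zero_mem _
  let S := separableClosure K L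
  let a : S := ⟨z ^ n, h⟩
  have ha : a ≠ 0 := fun h0 ↦ pow_ne_zero n hz (congrArg Subtype.val h0)
  have hnS : (n : S) ≠ 0 := by
    rw [← map_natCast (algebraMap K S)]
    exact (map_ne_zero _).2 hn
  have hzS : IsSeparable S z :=
    (Polynomial.separable_X_pow_sub_C a hnS ha).of_dvd (minpoly.dvd S z (by simp [a]))
  rw [← mem_separableClosure_iff, separableClosure.separableClosure_eq_bot,
    IntermediateField.mem_bot] at hzS
  obtain ⟨w, rfl⟩ := hzS
  exact w.2

lemma restrictRootsOfUnity_three_eq_or_eq_sq {R F : Type*} [CommRing R] [IsDomain R]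
    [FunLike F R R] [MonoidHomClass F R R] {σ : F} (hσ : Function.Injective σ)
    {ζ : rootsOfUnity 3 R} (hζ : IsPrimitiveRoot (ζ : Rˣ).val 3) :
    restrictRootsOfUnity σ 3 ζ = ζ ∨ restrictRootsOfUnity σ 3 ζ = ζ ^ 2 := by
  have hσζ := hζ.map_of_injective hσ
  obtain ⟨i, hi3, hi⟩ := hζ.eq_pow_of_pow_eq_one hσζ.pow_eq_one
  have hval {ξ : rootsOfUnity 3 R} (h : (ξ : Rˣ).val = σ (ζ : Rˣ).val) :
      restrictRootsOfUnity σ 3 ζ = ξ :=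
    Subtype.ext (Units.ext h.symm)
  interval_cases i
  · exact absurd (hi.symm.trans (pow_zero _)) (hσζ.ne_one (by norm_num))
  · exact .inl (hval ((pow_one _).symm.trans hi))
  · exact .inr (hval hi)

attribute [local instance] AddSubgroup.torsionBy.zmodModule

/-- The action of the endomorphisms of an abelian group on its `n`-torsion. -/
def torsionEnd (A : Type*) [AddCommGroup A] (n : ℕ) :
    AddMonoid.End A →+* Module.End (ZMod n) (AddSubgroup.torsionBy A (n : ℤ)) where
  toFun f := AddMonoidHom.toZModLinearMap n
    { toFun P := ⟨f P, by
        rw [AddSubgroup.torsionBy.nsmul_iff, ← map_nsmul,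
          AddSubgroup.torsionBy.nsmul_iff.1 P.2, map_zero]⟩
      map_zero' := Subtype.ext (map_zero f)
      map_add' P Q := Subtype.ext (map_add f _ _) }
  map_one' := rfl
  map_mul' _ _ := rfl
  map_zero' := rfl
  map_add' _ _ := rfl

variable {K L : Type*} [Field K] [Field L] [Algebra K L] [DecidableEq L] (W : WeierstrassCurve K)

/-- The action of the `K`-automorphisms of `L` on the `L`-rational points of `W`. -/
noncomputable def galPointAction (L : Type*) [Field L] [Algebra K L] [DecidableEq L] :
    Gal(L/K) →* AddMonoid.End (W.baseChange L).toAffine.Point where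
  toFun σ := Point.map σ.toAlgHom
  map_one' := by
    ext (_ | _) <;> rfl
  map_mul' σ τ := by
    ext (_ | _) <;> rfl

/-- The Galois representation on the `n`-torsion of the points of `W` over `L`. -/
noncomputable def galTorsionRep (L : Type*) [Field L] [Algebra K L] [DecidableEq L] (n : ℕ) :
    Representation (ZMod n) Gal(L/K)
      (AddSubgroup.torsionBy (W.baseChange L).toAffine.Point (n : ℤ)) :=
  (torsionEnd _ n).toMonoidHom.comp (galPointAction W L)

lemma ker_galTorsionRep (n : ℕ) :
    (galTorsionRep W L n).ker = (divisionField W L n).fixingSubgroup := by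
  ext σ
  rw [IntermediateField.mem_fixingSubgroup_iff, MonoidHom.mem_ker, divisionField]
  refine Iff.trans ?_ (IntermediateField.forall_mem_adjoin_smul_eq_self_iff K σ).symm
  constructor
  · rintro hσ z ⟨x, y, h, hn, hz⟩
    have hfix := congrArg Subtype.val
      (LinearMap.congr_fun hσ ⟨.some x y h, AddSubgroup.torsionBy.nsmul_iff.2 hn⟩)
    obtain ⟨hx, hy⟩ := Point.some.inj hfix
    rcases hz with rfl | rfl
    exacts [hx, hy]
  · refine fun hσ ↦ LinearMap.ext ?_
    rintro ⟨_ | ⟨x, y, h⟩, hP⟩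
    · rfl
    · have hn := AddSubgroup.torsionBy.nsmul_iff.1 hP
      have hx : σ x = x := hσ x ⟨x, y, h, hn, .inl rfl⟩
      have hy : σ y = y := hσ y ⟨x, y, h, hn, .inr rfl⟩
      refine Subtype.ext ((Point.some.injEq ..).mpr ⟨hx, hy⟩)

instance normal_divisionField [Normal K L] (n : ℕ) : Normal K (divisionField W L n) := by
  refine IntermediateField.normal_iff_forall_map_le.2 fun σ ↦ ?_
  rw [divisionField, IntermediateField.adjoin_map]
  refine IntermediateField.adjoin.mono _ _ _ ?_
  rintro _ ⟨z, ⟨x, y, h, hn, hz⟩, rfl⟩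
  refine ⟨σ x, σ y, (baseChange_nonsingular W σ.injective ..).2 h, ?_, ?_⟩
  · rw [← Point.map_some σ h, ← map_nsmul, hn, map_zero]
  · exact hz.imp (congrArg σ) (congrArg σ)

lemma mem_range_map_val {x y : L} (h : (W.baseChange L).toAffine.Nonsingular x y)
    (E : IntermediateField K L) (hx : x ∈ E) (hy : y ∈ E) :
    .some x y h ∈ (Point.map (W' := W) E.val).range :=
  ⟨.some ⟨x, hx⟩ ⟨y, hy⟩ ((baseChange_nonsingular W E.val.injective ..).1 h), rfl⟩

lemma isSeparable_divisionField {n : ℕ}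
    (h : AddSubgroup.torsionBy (W.baseChange L).toAffine.Point (n : ℤ) ≤
      (Point.map (W' := W) (separableClosure K L).val).range) :
    Algebra.IsSeparable K (divisionField W L n) := by
  refine (IntermediateField.isSeparable_adjoin_iff_isSeparable K L).2 ?_
  rintro z ⟨x, y, hxy, hn, hz⟩
  obtain ⟨_ | ⟨u, v, huv⟩, hQ⟩ := h (AddSubgroup.torsionBy.nsmul_iff.2 hn)
  · cases hQ
  obtain ⟨rfl, rfl⟩ := Point.some.inj hQ
  rw [← mem_separableClosure_iff]
  rcases hz with rfl | rfl
  exacts [u.2, v.2]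

end DivisionFields

section MordellCurve

open WeierstrassCurve.Affine

/-- The `F`-rational points of `y² = x³ + c`. -/
abbrev MordellPoint {K : Type*} [Field K] (c : K) (F : Type*) [Field F] [Algebra K F] : Type _ :=
  ((mordellCurve c).baseChange F).toAffine.Point

variable {K : Type*} [Field K] {c : K}

@[simp] lemma mordellCurve_a₁ : (mordellCurve c).a₁ = 0 := rfl
@[simp] lemma mordellCurve_a₂ : (mordellCurve c).a₂ = 0 := rfl
@[simp] lemma mordellCurve_a₃ : (mordellCurve c).a₃ = 0 := rfl
@[simp] lemma mordellCurve_a₄ : (mordellCurve c).a₄ = 0 := rfl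
@[simp] lemma mordellCurve_a₆ : (mordellCurve c).a₆ = c := rfl

lemma mordellCurve_Δ : (mordellCurve c).Δ = -432 * c ^ 2 := by
  simp [WeierstrassCurve.Δ, WeierstrassCurve.b₂, WeierstrassCurve.b₄, WeierstrassCurve.b₆,
    WeierstrassCurve.b₈]
  ring

variable {F : Type*} [Field F] [Algebra K F]

variable (c F) in
lemma ne_zero_of_isElliptic_mordellCurve [h : (mordellCurve c).IsElliptic] :
    (2 : F) ≠ 0 ∧ (3 : F) ≠ 0 ∧ algebraMap K F c ≠ 0 := by
  have hΔ : -(2 : F) ^ 4 * 3 ^ 3 * algebraMap K F c ^ 2 = algebraMap K F (mordellCurve c).Δ := by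
    simp only [mordellCurve_Δ, map_mul, map_neg, map_pow, map_ofNat]
    ring
  have hne := (map_ne_zero (algebraMap K F)).2 h.isUnit.ne_zero
  rw [← hΔ] at hne
  simpa [not_or, and_assoc] using hne

lemma mordellCurve_nonsingular_iff [(mordellCurve c).IsElliptic] (x y : F) :
    ((mordellCurve c).baseChange F).toAffine.Nonsingular x y ↔
      y ^ 2 = x ^ 3 + algebraMap K F c := by
  have : ((mordellCurve c).baseChange F).IsElliptic := by
    unfold WeierstrassCurve.baseChange
    infer_instance
  simp [← equation_iff_nonsingular, equation_iff]

lemma mordellCurve_negY (x y : F) :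
    ((mordellCurve c).baseChange F).toAffine.negY x y = -y := by
  simp [negY]

lemma mordellCurve_addX (x₁ x₂ l : F) :
    ((mordellCurve c).baseChange F).toAffine.addX x₁ x₂ l = l ^ 2 - x₁ - x₂ := by
  simp [addX]

lemma mordellCurve_addY (x₁ x₂ y₁ l : F) :
    ((mordellCurve c).baseChange F).toAffine.addY x₁ x₂ y₁ l =
      -(l * (l ^ 2 - x₁ - x₂ - x₁) + y₁) := by
  simp [addY, negAddY]

variable [DecidableEq F]

lemma mordellCurve_slope (x₁ x₂ y₁ y₂ : F) :
    ((mordellCurve c).baseChange F).toAffine.slope x₁ x₂ y₁ y₂ =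
      if x₁ = x₂ then if y₁ = -y₂ then 0 else 3 * x₁ ^ 2 / (2 * y₁)
      else (y₁ - y₂) / (x₁ - x₂) := by
  simp [WeierstrassCurve.Affine.slope, two_mul]

lemma mordellCurve_slope_mul {z : F} (hz : z ^ 3 = 1) (x₁ x₂ y₁ y₂ : F) :
    ((mordellCurve c).baseChange F).toAffine.slope (z * x₁) (z * x₂) y₁ y₂ =
      z ^ 2 * ((mordellCurve c).baseChange F).toAffine.slope x₁ x₂ y₁ y₂ := by
  have hz0 : z ≠ 0 := by
    rintro rfl
    simp at hz
  simp only [mordellCurve_slope, mul_right_inj' hz0]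
  split_ifs with hx
  · rw [mul_zero]
  · ring
  · have hx' : x₁ - x₂ ≠ 0 := sub_ne_zero.2 hx
    rw [← mul_sub]
    field_simp
    linear_combination (-(y₁ - y₂)) * hz

variable [(mordellCurve c).IsElliptic]

/-- The automorphism `(x, y) ↦ (zx, y)` of `y² = x³ + c`, where `z³ = 1`. -/
def mordellScale {z : F} (hz : z ^ 3 = 1) : AddMonoid.End (MordellPoint c F) where
  toFun
    | 0 => 0
    | .some x y h => .some (z * x) y <| by
        rw [mordellCurve_nonsingular_iff] at h ⊢
        rw [h, mul_pow, hz, one_mul]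
  map_zero' := rfl
  map_add' := by
    have hz0 : z ≠ 0 := by
      rintro rfl
      simp at hz
    rintro (_ | ⟨x₁, y₁, h₁⟩) (_ | ⟨x₂, y₂, h₂⟩)
    any_goals rfl
    by_cases hxy : x₁ = x₂ ∧ y₁ = -y₂
    · rw [Point.add_of_Y_eq hxy.1 (by simpa using hxy.2),
        Point.add_of_Y_eq (by rw [hxy.1]) (by simpa using hxy.2)]
    · rw [Point.add_some (by simpa using hxy), Point.add_some (by simpa [hz0] using hxy)]
      simp only [mordellCurve_slope_mul hz, mordellCurve_addX, mordellCurve_addY, Point.some.injEq]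
      generalize ((mordellCurve c).baseChange F).toAffine.slope x₁ x₂ y₁ y₂ = l
      constructor
      · linear_combination (-z * l ^ 2) * hz
      · linear_combination (l ^ 3 * (z ^ 3 + 1) - l * (2 * x₁ + x₂)) * hz

variable (c F) in
/-- The action of the cube roots of unity on the points of `y² = x³ + c` by scaling the first
coordinate. -/
def mordellRot : rootsOfUnity 3 F →* AddMonoid.End (MordellPoint c F) where
  toFun ζ := mordellScale ((mem_rootsOfUnity' 3 _).1 ζ.2)
  map_one' := by
    ext (_ | ⟨x, y, h⟩)
    · rfl
    · exact (Point.some.injEq ..).mpr ⟨one_mul x, rfl⟩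
  map_mul' ζ ξ := by
    ext (_ | ⟨x, y, h⟩)
    · rfl
    · exact (Point.some.injEq ..).mpr ⟨mul_assoc _ _ x, rfl⟩

-- The three points `(x, y)`, `(ζx, y)`, `(ζ²x, y)` are collinear, hence sum to zero.
lemma mordellRot_add_self {ζ : rootsOfUnity 3 F} (hζ : IsPrimitiveRoot (ζ : Fˣ).val 3) {x y : F}
    (h : ((mordellCurve c).baseChange F).toAffine.Nonsingular x y) :
    mordellRot c F ζ (.some x y h) + .some x y h = -mordellRot c F (ζ ^ 2) (.some x y h) := by
  obtain ⟨h2, -, hc⟩ := ne_zero_of_isElliptic_mordellCurve c F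
  have heq := (mordellCurve_nonsingular_iff x y).1 h
  have hx0 (hx : (ζ : Fˣ).val * x = x) : x = 0 := by
    by_contra h0
    exact hζ.ne_one (by norm_num) ((mul_eq_right₀ h0).1 hx)
  have hne : ¬((ζ : Fˣ).val * x = x ∧ y = -y) := by
    rintro ⟨hx, hy⟩
    have hy0 : y = 0 := by
      refine (mul_eq_zero.1 (?_ : 2 * y = 0)).resolve_left h2
      linear_combination hy
    rw [hx0 hx, hy0] at heq
    exact hc (by linear_combination -heq)
  have hslope : ((mordellCurve c).baseChange F).toAffine.slope ((ζ : Fˣ).val * x) x y y = 0 := by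
    rw [mordellCurve_slope]
    split_ifs with hx
    · rfl
    · simp [hx0 hx]
    · simp
  refine (Point.add_some (by simpa using hne)).trans ((Point.some.injEq ..).mpr ?_)
  simp only [hslope, mordellCurve_addX, mordellCurve_addY, mordellCurve_negY]
  constructor
  · have hsum := hζ.geom_sum_eq_zero (by norm_num)
    simp only [Finset.sum_range_succ, Finset.sum_range_zero] at hsum
    push_cast
    linear_combination -x * hsum
  · ring

lemma mordellRot_sq_add_self_add_one {ζ : rootsOfUnity 3 F}
    (hζ : IsPrimitiveRoot (ζ : Fˣ).val 3) :
    mordellRot c F ζ ^ 2 + mordellRot c F ζ + 1 = 0 := by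
  ext (_ | ⟨x, y, h⟩)
  · rfl
  · calc (mordellRot c F ζ ^ 2) (.some x y h) + mordellRot c F ζ (.some x y h) + .some x y h
        = mordellRot c F (ζ ^ 2) (.some x y h) +
            (mordellRot c F ζ (.some x y h) + .some x y h) := by
          rw [map_pow, add_assoc]
      _ = 0 := by rw [mordellRot_add_self hζ, add_neg_cancel]

lemma mul_sq_of_mordellRot_eq_two_nsmul {ζ : rootsOfUnity 3 F} {x y : F}
    {h : ((mordellCurve c).baseChange F).toAffine.Nonsingular x y}
    (hP : mordellRot c F ζ (.some x y h) = 2 • .some x y h) :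
    x ≠ 0 ∧ 9 * x ^ 3 = 4 * (2 + (ζ : Fˣ).val) * y ^ 2 := by
  obtain ⟨h2, -, -⟩ := ne_zero_of_isElliptic_mordellCurve c F
  have hy : y ≠ -y := by
    intro hy
    rw [two_nsmul, Point.add_self_of_Y_eq (by simpa using hy)] at hP
    cases hP
  have hy0 : y ≠ 0 := fun h0 ↦ hy (by rw [h0, neg_zero])
  rw [two_nsmul, Point.add_self_of_Y_ne (by simpa using hy)] at hP
  obtain ⟨hX, hY⟩ := Point.some.inj hP
  simp only [mordellCurve_slope, if_true, if_neg hy, mordellCurve_addX, mordellCurve_addY] at hX hY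
  have hx0 : x ≠ 0 := by
    rintro rfl
    exact hy (by simpa using hY)
  refine ⟨hx0, ?_⟩
  field_simp at hX
  linear_combination -hX

lemma coordinates_of_mordellRot_eq_two_nsmul {ζ : rootsOfUnity 3 F} {x y : F}
    {h : ((mordellCurve c).baseChange F).toAffine.Nonsingular x y}
    (hP : mordellRot c F ζ (.some x y h) = 2 • .some x y h) :
    x ≠ 0 ∧ x ^ 3 = 4 * (2 + (ζ : Fˣ).val) * algebraMap K F c / (1 - 4 * (ζ : Fˣ).val) ∧
      y ^ 2 = x ^ 3 + algebraMap K F c := by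
  obtain ⟨h2, h3, hc⟩ := ne_zero_of_isElliptic_mordellCurve c F
  obtain ⟨hx, he⟩ := mul_sq_of_mordellRot_eq_two_nsmul hP
  have heq := (mordellCurve_nonsingular_iff x y).1 h
  have hmul : x ^ 3 * (1 - 4 * (ζ : Fˣ).val) = 4 * (2 + (ζ : Fˣ).val) * algebraMap K F c := by
    linear_combination he + 4 * (2 + (ζ : Fˣ).val) * heq
  have hden : 1 - 4 * (ζ : Fˣ).val ≠ 0 := by
    intro h0
    have hζ : (2 + (ζ : Fˣ).val) * (2 ^ 2 * algebraMap K F c) = 0 := by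
      linear_combination -hmul + x ^ 3 * h0
    have h9 : (3 : F) ^ 2 = 0 := by
      linear_combination h0 + 4 * (mul_eq_zero.1 hζ).resolve_right (by simp [h2, hc])
    exact h3 (pow_eq_zero_iff two_ne_zero |>.1 h9)
  exact ⟨hx, by rw [eq_div_iff hden, hmul], heq⟩

lemma exists_eq_or_eq_neg_of_mordellRot_eq_two_nsmul {ζ : rootsOfUnity 3 F}
    (hζ : IsPrimitiveRoot (ζ : Fˣ).val 3) {P Q : MordellPoint c F} (hP0 : P ≠ 0) (hQ0 : Q ≠ 0)
    (hP : mordellRot c F ζ P = 2 • P) (hQ : mordellRot c F ζ Q = 2 • Q) :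
    ∃ i : ℕ, Q = mordellRot c F (ζ ^ i) P ∨ Q = -mordellRot c F (ζ ^ i) P := by
  rcases P with _ | ⟨x, y, h⟩
  · exact absurd rfl hP0
  rcases Q with _ | ⟨u, v, h'⟩
  · exact absurd rfl hQ0
  obtain ⟨hx0, hx, -⟩ := coordinates_of_mordellRot_eq_two_nsmul hP
  obtain ⟨-, hu, -⟩ := coordinates_of_mordellRot_eq_two_nsmul hQ
  have hux : (u / x) ^ 3 = 1 := by
    rw [div_pow, hu, ← hx, div_self (pow_ne_zero 3 hx0)]
  obtain ⟨i, -, hi⟩ := hζ.eq_pow_of_pow_eq_one hux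
  refine ⟨i, Point.X_eq_iff.1 ?_⟩
  rw [eq_div_iff hx0] at hi
  exact hi.symm

end MordellCurve

section MordellTorsion

open Module WeierstrassCurve.Affine

attribute [local instance] AddSubgroup.torsionBy.zmodModule

variable {K : Type*} [Field K] (c : K) [(mordellCurve c).IsElliptic]
  (L : Type*) [Field L] [Algebra K L] [DecidableEq L]

/-- The action of the cube roots of unity on the `n`-torsion of `y² = x³ + c`. -/
def mordellTorsionRot (n : ℕ) :
    rootsOfUnity 3 L →* End (ZMod n) (AddSubgroup.torsionBy (MordellPoint c L) (n : ℤ)) :=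
  (torsionEnd _ n).toMonoidHom.comp (mordellRot c L)

variable {c L} {ζ : rootsOfUnity 3 L}

lemma mordellTorsionRot_sq_add_self_add_one (hζ : IsPrimitiveRoot (ζ : Lˣ).val 3) (n : ℕ) :
    mordellTorsionRot c L n ζ ^ 2 + mordellTorsionRot c L n ζ + 1 = 0 := by
  calc mordellTorsionRot c L n ζ ^ 2 + mordellTorsionRot c L n ζ + 1
      = torsionEnd _ n (mordellRot c L ζ ^ 2 + mordellRot c L ζ + 1) := rfl
    _ = 0 := by rw [mordellRot_sq_add_self_add_one hζ, map_zero]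

lemma mem_eigenspace_two_mordellTorsionRot {n : ℕ}
    {P : AddSubgroup.torsionBy (MordellPoint c L) (n : ℤ)} :
    P ∈ (mordellTorsionRot c L n ζ).eigenspace 2 ↔ mordellRot c L ζ P.1 = 2 • P.1 := by
  rw [End.mem_eigenspace_iff, ofNat_smul_eq_nsmul, Subtype.ext_iff]
  rfl

lemma isPrincipal_eigenspace_two_mordellTorsionRot (hζ : IsPrimitiveRoot (ζ : Lˣ).val 3) (n : ℕ) :
    ((mordellTorsionRot c L n ζ).eigenspace 2).IsPrincipal := by
  by_cases hbot : (mordellTorsionRot c L n ζ).eigenspace 2 = ⊥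
  · rw [hbot]
    infer_instance
  obtain ⟨P, hP, hP0⟩ := Submodule.exists_mem_ne_zero_of_ne_bot hbot
  refine ⟨P, le_antisymm (fun Q hQ ↦ ?_) ((Submodule.span_singleton_le_iff_mem ..).2 hP)⟩
  rcases eq_or_ne Q 0 with rfl | hQ0
  · exact zero_mem _
  obtain ⟨i, hi⟩ := exists_eq_or_eq_neg_of_mordellRot_eq_two_nsmul hζ
    (P := P.1) (Q := Q.1) (by simpa using hP0) (by simpa using hQ0)
    (mem_eigenspace_two_mordellTorsionRot.1 hP) (mem_eigenspace_two_mordellTorsionRot.1 hQ)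
  have hpow : mordellTorsionRot c L n (ζ ^ i) P = (2 : ZMod n) ^ i • P := by
    rw [map_pow]
    exact End.HasEigenvector.pow_apply ⟨hP, hP0⟩ i
  have hmem : mordellTorsionRot c L n (ζ ^ i) P ∈ ZMod n ∙ P :=
    hpow ▸ Submodule.smul_mem _ _ (Submodule.mem_span_singleton_self P)
  rcases hi with hi | hi
  · exact (Subtype.ext hi : Q = mordellTorsionRot c L n (ζ ^ i) P) ▸ hmem
  · exact (Subtype.ext hi : Q = -mordellTorsionRot c L n (ζ ^ i) P) ▸ neg_mem hmem

lemma eigenspace_four_mordellTorsionRot (hζ : IsPrimitiveRoot (ζ : Lˣ).val 3) :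
    (mordellTorsionRot c L 7 ζ).eigenspace 4 = (mordellTorsionRot c L 7 (ζ ^ 2)).eigenspace 2 := by
  rw [map_pow, eigenspace_sq_eq (mordellTorsionRot_sq_add_self_add_one hζ 7)]
  rfl

lemma galTorsionRep_mul_mordellTorsionRot (σ : Gal(L/K)) (ζ : rootsOfUnity 3 L) (n : ℕ) :
    galTorsionRep (mordellCurve c) L n σ * mordellTorsionRot c L n ζ =
      mordellTorsionRot c L n (restrictRootsOfUnity σ 3 ζ) *
        galTorsionRep (mordellCurve c) L n σ := by
  have hpoint : galPointAction (mordellCurve c) L σ * mordellRot c L ζ =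
      mordellRot c L (restrictRootsOfUnity σ 3 ζ) * galPointAction (mordellCurve c) L σ := by
    ext (_ | ⟨x, y, h⟩)
    · rfl
    · exact (Point.some.injEq ..).mpr ⟨map_mul σ _ x, rfl⟩
  exact congrArg (torsionEnd _ n) hpoint

lemma mem_range_separableClosure_of_mordellRot_eq_two_nsmul {P : MordellPoint c L}
    (hP : mordellRot c L ζ P = 2 • P) :
    P ∈ (Point.map (W' := mordellCurve c) (separableClosure K L).val).range := by
  rcases P with _ | ⟨x, y, h⟩
  · exact zero_mem _
  obtain ⟨h2, h3, -⟩ := ne_zero_of_isElliptic_mordellCurve c K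
  obtain ⟨-, hx, hy⟩ := coordinates_of_mordellRot_eq_two_nsmul hP
  have hζS : (ζ : Lˣ).val ∈ separableClosure K L :=
    mem_separableClosure_of_pow_mem (n := 3) (mod_cast h3)
      ((mem_rootsOfUnity' 3 _).1 ζ.2 ▸ one_mem _)
  have hcS : algebraMap K L c ∈ separableClosure K L := algebraMap_mem _ c
  have hnatS (n : ℕ) [n.AtLeastTwo] : (OfNat.ofNat n : L) ∈ separableClosure K L :=
    ofNat_mem _ n
  have hx3S : x ^ 3 ∈ separableClosure K L := by
    rw [hx]
    exact div_mem (mul_mem (mul_mem (hnatS 4) (add_mem (hnatS 2) hζS)) hcS)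
      (sub_mem (one_mem _) (mul_mem (hnatS 4) hζS))
  exact mem_range_map_val _ h _ (mem_separableClosure_of_pow_mem (mod_cast h3) hx3S)
    (mem_separableClosure_of_pow_mem (n := 2) (mod_cast h2) (hy ▸ add_mem hx3S hcS))

variable {ω : L}

lemma isSeparable_divisionField_mordellCurve (hω : IsPrimitiveRoot ω 3) :
    Algebra.IsSeparable K (divisionField (mordellCurve c) L 7) := by
  refine isSeparable_divisionField _ fun P hP ↦ ?_
  let ζ := hω.toRootsOfUnity
  have hsup := (isCompl_eigenspace_two_four
    (mordellTorsionRot_sq_add_self_add_one (c := c) (ζ := ζ) hω 7)).sup_eq_top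
  rw [eigenspace_four_mordellTorsionRot hω] at hsup
  obtain ⟨A, hA, B, hB, hAB⟩ := Submodule.mem_sup.1
    (hsup ▸ Submodule.mem_top : (⟨P, hP⟩ : AddSubgroup.torsionBy (MordellPoint c L) (7 : ℕ)) ∈ _)
  have hABP : A.1 + B.1 = P := congrArg Subtype.val hAB
  rw [← hABP]
  exact add_mem
    (mem_range_separableClosure_of_mordellRot_eq_two_nsmul
      (mem_eigenspace_two_mordellTorsionRot.1 hA))
    (mem_range_separableClosure_of_mordellRot_eq_two_nsmul
      (mem_eigenspace_two_mordellTorsionRot.1 hB))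

lemma exists_monoidHom_ker_eq_fixingSubgroup_divisionField (hω : IsPrimitiveRoot ω 3) :
    ∃ f : Gal(L/K) →* Dic3SemidirectC6,
      f.ker = (divisionField (mordellCurve c) L 7).fixingSubgroup := by
  let ζ := hω.toRootsOfUnity
  have h4 : ((mordellTorsionRot c L 7 ζ).eigenspace 4).IsPrincipal := by
    rw [eigenspace_four_mordellTorsionRot hω]
    exact isPrincipal_eigenspace_two_mordellTorsionRot (hω.pow_of_coprime 2 (by norm_num)) 7
  rw [← ker_galTorsionRep]
  refine exists_monoidHom_ker_eq_of_semilinear _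
    (mordellTorsionRot_sq_add_self_add_one (ζ := ζ) hω 7)
    (isPrincipal_eigenspace_two_mordellTorsionRot (ζ := ζ) hω 7) h4 fun σ ↦ ?_
  rw [galTorsionRep_mul_mordellTorsionRot, ← map_pow]
  exact (restrictRootsOfUnity_three_eq_or_eq_sq σ.injective hω).imp (by rw [·]) (by rw [·])

end MordellTorsion

theorem theorem6_general {K : Type*} [Field K] (L : Type*) [Field L] [Algebra K L] [Normal K L]
    [DecidableEq L] {ω : L} (hω : IsPrimitiveRoot ω 3) (c : K) [(mordellCurve c).IsElliptic] :
    IsGalois K (divisionField (mordellCurve c) L 7) ∧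
    (∃ S : Subgroup Dic3SemidirectC6,
      Nonempty (Gal(divisionField (mordellCurve c) L 7/K) ≃* S)) ∧
    (Module.finrank K (divisionField (mordellCurve c) L 7) = 72 →
      Nonempty (Gal(divisionField (mordellCurve c) L 7/K) ≃* Dic3SemidirectC6)) ∧
    IsEmpty (Dic3SemidirectC6 ≃* Dic3 × C6) := by
  have hsep := isSeparable_divisionField_mordellCurve (c := c) hω
  have hgal : IsGalois K (divisionField (mordellCurve c) L 7) := ⟨⟩
  obtain ⟨f, hf⟩ := exists_monoidHom_ker_eq_fixingSubgroup_divisionField (c := c) hω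
  obtain ⟨e⟩ := nonempty_gal_mulEquiv_range _ hf
  refine ⟨hgal, ⟨f.range, ⟨e⟩⟩, fun h72 ↦ ?_, isEmpty_dic3SemidirectC6_mulEquiv_prod⟩
  have : FiniteDimensional K (divisionField (mordellCurve c) L 7) :=
    .of_finrank_pos (by rw [h72]; norm_num)
  have hcard : Nat.card f.range = Nat.card Dic3SemidirectC6 := by
    rw [← Nat.card_congr e.toEquiv, IsGalois.card_aut_eq_finrank, h72, card_dic3SemidirectC6]
  have : Finite Dic3SemidirectC6 :=
    Nat.finite_of_card_ne_zero (by rw [card_dic3SemidirectC6]; norm_num)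
  rw [Subgroup.eq_top_of_card_eq _ hcard] at e
  exact ⟨e.trans Subgroup.topEquiv⟩

theorem theorem6 {K : Type*} [Field K] (h2 : ringChar K ≠ 2) (h3 : ringChar K ≠ 3)
    (L : Type*) [Field L] [Algebra K L] [IsAlgClosure K L] [DecidableEq L]
    (c : K) [(mordellCurve c).IsElliptic] :
    IsGalois K (divisionField (mordellCurve c) L 7) ∧
    (∃ S : Subgroup Dic3SemidirectC6,
      Nonempty (Gal(divisionField (mordellCurve c) L 7/K) ≃* S)) ∧
    (Module.finrank K (divisionField (mordellCurve c) L 7) = 72 →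
      Nonempty (Gal(divisionField (mordellCurve c) L 7/K) ≃* Dic3SemidirectC6)) ∧
    IsEmpty (Dic3SemidirectC6 ≃* Dic3 × C6) := by
  have : IsAlgClosed L := IsAlgClosure.isAlgClosed K
  have : Normal K L := IsAlgClosure.normal K L
  have : NeZero ((3 : ℕ) : L) := ⟨mod_cast (ne_zero_of_isElliptic_mordellCurve c L).2.1⟩
  obtain ⟨ω, hω⟩ := HasEnoughRootsOfUnity.exists_primitiveRoot L 3
  exact theorem6_general L hω c
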